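/- Let $p$ be a prime and let $(R,m)$ be a Gorenstein local ring (a Noetherian local ring of finite injective dimension as a module over itself) of characteristic $p$ which is F-finite, i.e. $R$ is a finitely generated module over its subring $R^p=\{r^p : r\in R\}$. For $e\ge 0$ let $R^{1/p^e}$ denote the ring of (formal) $p^e$-th roots $r^{1/p^e}$ of the elements $r\in R$: it is the copy of the ring $R$ given by the ring isomorphism $r\mapsto r^{1/p^e}$, and it is viewed as an $R$-algebra via the $e$-th iterate of Frobenius, so that $r\cdot x^{1/p^e}=(r^{p^e}x)^{1/p^e}$. The group $\operatorname{Hom}_R(R^{1/p^e},R)$ is an $R^{1/p^e}$-module by $(s\cdot\varphi)(x)=\varphi(sx)$. For an $R$-linear map $\varphi:R^{1/p^e}\to R$, an ideal $J\subseteq R$ is called $\varphi$-compatible if $\varphi(J^{1/p^e})\subseteq J$, where $J^{1/p^e}=\{x^{1/p^e}: x\in J\}$; and $J$ is called uniformly $F$-compatible if it is $\varphi$-compatible for every $e$ and every $\varphi\in\operatorname{Hom}_R(R^{1/p^e},R)$. Then: 1. $\operatorname{Hom}_R(R^{1/p},R)$ is a cyclic $R^{1/p}$-module. 2. For every generator $\Psi$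 of the $R^{1/p}$-module $\operatorname{Hom}_R(R^{1/p},R)$ and every ideal $J$ of $R$, $J$ is uniformly $F$-compatible if and only if $J$ is $\Psi$-compatible. -/

import Mathlib

universe u

/-- The ring `R^{1/p^e}` of formal `p^e`-th roots of the elements of `R` (also written `F^e_* R`):
a second copy of the ring `R`, regarded below as an `R`-algebra through the `e`-th iterate of the
Frobenius map. For reduced `R` it is the usual ring of `p^e`-th roots containing `R`. -/
@[nolint unusedArguments]
def FrobRoot (R : Type u) (_p _e : ℕ) : Type u :=
  R

section FrobeniusRoots

variable (R : Type u) [CommRing R] (p : ℕ)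

namespace FrobRoot

variable (e : ℕ)

instance : CommRing (FrobRoot R p e) :=
  inferInstanceAs (CommRing R)

/-- The ring isomorphism `R ≃ R^{1/p^e}`, `r ↦ r^{1/p^e}`. -/
def root : R ≃+* FrobRoot R p e :=
  RingEquiv.refl R

variable [Fact p.Prime] [CharP R p]

/-- The `R`-algebra structure of `R^{1/p^e}`: the structure map is `r ↦ (r^{p^e})^{1/p^e}`. -/
instance : Algebra R (FrobRoot R p e) :=
  ((root R p e).toRingHom.comp (iterateFrobenius R p e)).toAlgebra

theorem algebraMap_apply (r : R) :
    algebraMap R (FrobRoot R p e) r = root R p e (r ^ p ^ e) :=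
  rfl

/-- The element `r^{1/p^e}` is indeed a `p^e`-th root of (the image of) `r`. -/
theorem root_pow (r : R) : root R p e r ^ p ^ e = algebraMap R (FrobRoot R p e) r := by
  rw [algebraMap_apply, map_pow]

theorem smul_root (r x : R) : r • root R p e x = root R p e (r ^ p ^ e * x) := by
  rw [Algebra.smul_def, algebraMap_apply, map_mul]

/-- The `R^{1/p^e}`-module structure of `Hom_R(R^{1/p^e}, R)`, by premultiplication:
`(s • φ) x = φ (s * x)`. -/
instance homModule : Module (FrobRoot R p e) (FrobRoot R p e →ₗ[R] R) where
  smul s φ := φ ∘ₗ LinearMap.mulLeft R s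
  one_smul φ := LinearMap.ext fun x => congrArg φ (one_mul x)
  mul_smul s t φ := LinearMap.ext fun x => congrArg φ (by
    change s * t * x = t * (s * x)
    ring)
  smul_zero _ := rfl
  smul_add _ _ _ := rfl
  add_smul s t φ := LinearMap.ext fun x =>
    (congrArg φ (add_mul s t x)).trans (map_add φ (s * x) (t * x))
  zero_smul φ := LinearMap.ext fun x => (congrArg φ (zero_mul x)).trans (map_zero φ)

theorem hom_smul_apply (s : FrobRoot R p e) (φ : FrobRoot R p e →ₗ[R] R)
    (x : FrobRoot R p e) : (s • φ) x = φ (s * x) :=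
  rfl

end FrobRoot

end FrobeniusRoots

section Compatibility

variable {R : Type u} [CommRing R] {p : ℕ}

/-- The ideal `J^{1/p^e} = {x^{1/p^e} | x ∈ J}` of `R^{1/p^e}`. -/
def Ideal.frobRoot (J : Ideal R) (p e : ℕ) : Ideal (FrobRoot R p e) :=
  J.map (FrobRoot.root R p e)

theorem Ideal.root_mem_frobRoot_iff (J : Ideal R) (e : ℕ) (x : R) :
    FrobRoot.root R p e x ∈ J.frobRoot p e ↔ x ∈ J := by
  rw [Ideal.frobRoot, Ideal.mem_map_of_equiv]
  simp

variable [Fact p.Prime] [CharP R p]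

/-- `J` is `φ`-compatible if `φ (J^{1/p^e}) ⊆ J`. -/
def Ideal.IsCompatible {e : ℕ} (J : Ideal R) (φ : FrobRoot R p e →ₗ[R] R) : Prop :=
  ∀ y ∈ J.frobRoot p e, φ y ∈ J

variable (p) in
/-- `J` is uniformly `F`-compatible if it is compatible with every `R`-linear map
`R^{1/p^e} → R`, for every `e`. -/
def Ideal.IsUniformlyFCompatible (J : Ideal R) : Prop :=
  ∀ (e : ℕ) (φ : FrobRoot R p e →ₗ[R] R), J.IsCompatible φ

end Compatibility

/-- A ring of characteristic `p` is F-finite if it is a finitely generated module over its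
subring `R^p` of `p`-th powers. -/
def IsFFinite (R : Type u) [CommRing R] (p : ℕ) [Fact p.Prime] [CharP R p] : Prop :=
  Module.Finite (frobenius R p).range R

/-- A Gorenstein local ring: a Noetherian local ring of finite injective dimension as a module
over itself. -/
class IsGorensteinLocalRing (R : Type u) [CommRing R] : Prop
    extends IsLocalRing R, IsNoetherianRing R where
  exists_hasInjectiveDimensionLE :
    ∃ n : ℕ, CategoryTheory.HasInjectiveDimensionLE (ModuleCat.of R R) n

/-! ### Vanishing of Ext, and equality of depth and injective dimension. -/

section InjectiveDimension

open CategoryTheory Abelian IsLocalRing RingTheory.Sequence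

variable {R : Type u} [CommRing R]

/-! Write `S` for `R^{1/p}`. The core is that `Hom_R(S, R)` is free of rank one over `S`
(`exists_frobenius_trace`); no canonical modules are used, only reduction modulo a regular sequence
`rs` whose length `d` is both depth and injective dimension. On modules killed by `rs`, `Hom(-,
R/(rs))` behaves like `Ext^d(-, R)`, so `R/(rs)` is injective relative to finite modules of this
kind and has simple socle. As `rs` acts on `S` through `p`-th powers, `S/(rs)S` is `R/(rs^p)`, which
has simple socle for the same reason. Matching the two socles and applying Nakayama gives a
generator of `Hom_R(S, R/(rs))` with annihilator `(rs)S` (`exists_generator_of_isInjectiveModulo`).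
Since `rs` is also `S`-regular, `Ext^j_R(S, R)` vanishes for `j > 0`, and the generator lifts
through one regular element at a time (`exists_generator_of_quotient`).

Given a free generator `Ψ`, every map from `R^{1/p^{e+1}}` factors as `Ψ` after the `p`-th root of
an `R`-linear map from `R^{1/p^e}`. Compatibility with `Ψ` therefore propagates to all `e` by
induction. -/

theorem ext_comp_smul_id_eq_zero {K N : ModuleCat.{u} R} {x : R}
    (hK : x ∈ Module.annihilator R K) {j : ℕ} (α : Ext K N j) :
    α.comp (Ext.mk₀ (x • 𝟙 N)) (add_zero j) = 0 :=
  congrArg (fun f => f.hom α) (Ext.postcomp_smul_id_eq_zero_of_mem_annihilator (M := N) hK j)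

theorem LinearMap.shortExact_mkQ_range {M' M : Type u} [AddCommGroup M'] [Module R M']
    [AddCommGroup M] [Module R M] (f : M' →ₗ[R] M) (hf : Function.Injective f) :
    (ModuleCat.shortComplexOfCompEqZero f f.range.mkQ f.range_mkQ_comp).ShortExact where
  exact := ModuleCat.shortComplex_exact _ f.exact_map_mkQ_range
  mono_f := (ModuleCat.mono_iff_injective _).mpr hf
  epi_g := (ModuleCat.epi_iff_surjective _).mpr (Submodule.mkQ_surjective _)

/-- If `Ext^{j+1}(M ⧸ xM, N)` vanishes, then `x` acts surjectively on `Ext^j(M, N)`. -/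
theorem exists_smul_eq_of_subsingleton_ext_quotSMulTop {M : ModuleCat.{u} R} (N : ModuleCat.{u} R)
    {x : R} (hx : IsSMulRegular M x) (j : ℕ)
    [Subsingleton (Ext (ModuleCat.of R (QuotSMulTop x M)) N (j + 1))] (α : Ext M N j) :
    ∃ β : Ext M N j, x • β = α := by
  obtain ⟨β, hβ⟩ := Ext.contravariant_sequence_exact₁ hx.smulShortComplex_shortExact N
    (α : Ext (M.smulShortComplex x).X₁ N j) (n₁ := j + 1) (add_comm 1 j)
    (Subsingleton.elim (α := Ext (ModuleCat.of R (QuotSMulTop x M)) N (j + 1)) _ _)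
  have h : ∀ γ : Ext M N j, (Ext.mk₀ (x • 𝟙 M)).comp γ (zero_add j) = x • γ := fun γ => by
    rw [Ext.mk₀_smul, Ext.smul_comp, Ext.mk₀_id_comp]
  exact ⟨β, (h β).symm.trans hβ⟩

/-- If `x` kills `K` and `Ext^j(K, N ⧸ xN)` vanishes, then `Ext^{j+1}(K, N)` vanishes. -/
theorem subsingleton_ext_succ_of_quotSMulTop (K : ModuleCat.{u} R) {N : ModuleCat.{u} R} {x : R}
    (hx : IsSMulRegular N x) (hK : x ∈ Module.annihilator R K) (j : ℕ)
    (h : Subsingleton (Ext K (ModuleCat.of R (QuotSMulTop x N)) j)) :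
    Subsingleton (Ext K N (j + 1)) := by
  refine subsingleton_of_forall_eq 0 fun α => ?_
  obtain ⟨β, rfl⟩ := Ext.covariant_sequence_exact₁ K hx.smulShortComplex_shortExact α
    (ext_comp_smul_id_eq_zero hK α) rfl
  exact (congrArg (fun γ : Ext K (N.smulShortComplex x).X₃ j => γ.comp _ rfl)
    (h.elim β 0)).trans (Ext.zero_comp _ _ _ _ _)

/-- If the modules `K` and `N ⧸ (rs)N` admit no nonzero homomorphism, where `rs` is a weakly
`N`-regular sequence killing `K`, then `Ext^d(K, N)` vanishes for `d` the length of `rs`. -/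
theorem subsingleton_ext_length (K : ModuleCat.{u} R) {N : Type u} [AddCommGroup N] [Module R N]
    {rs : List R} (hreg : IsWeaklyRegular N rs) (hK : ∀ r ∈ rs, r ∈ Module.annihilator R K)
    (h : Subsingleton (K →ₗ[R] N ⧸ (Ideal.ofList rs • ⊤ : Submodule R N))) :
    Subsingleton (Ext K (ModuleCat.of R N) rs.length) := by
  induction hreg with
  | nil N =>
    have e : (N ⧸ (Ideal.ofList ([] : List R) • ⊤ : Submodule R N)) ≃ₗ[R] N :=
      Submodule.quotEquivOfEqBot _ (by simp)
    have : Subsingleton (K →ₗ[R] N) := (LinearEquiv.congrRight (M := K) e).symm.subsingleton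
    exact (Ext.addEquiv₀.trans (ModuleCat.homAddEquiv (N := ModuleCat.of R N))).subsingleton
  | @cons N _ _ x rs hx _ ih =>
    have := (LinearEquiv.congrRight (M := K)
      (Submodule.quotOfListConsSMulTopEquivQuotSMulTopInner N x rs)).symm.subsingleton
    exact subsingleton_ext_succ_of_quotSMulTop K (N := ModuleCat.of R N) hx
      (hK x List.mem_cons_self) _ (ih (fun r hr => hK r (List.mem_cons_of_mem _ hr)) this)

theorem subsingleton_of_forall_exists_smul_eq [IsLocalRing R] {M : Type*} [AddCommGroup M]
    [Module R M] [Module.Finite R M] {x : R} (hx : x ∈ maximalIdeal R)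
    (h : ∀ m : M, ∃ m', x • m' = m) : Subsingleton M := by
  rw [← Submodule.subsingleton_iff R, ← subsingleton_iff_bot_eq_top, eq_comm]
  refine Submodule.eq_bot_of_le_smul_of_le_jacobson_bot (Ideal.span {x}) ⊤ Module.Finite.fg_top
    (fun m _ => ?_) ?_
  · obtain ⟨m', rfl⟩ := h m
    exact Submodule.smul_mem_smul (Ideal.mem_span_singleton_self x) trivial
  · rw [IsLocalRing.jacobson_eq_maximalIdeal ⊥ bot_ne_top]
    exact (Ideal.span_singleton_le_iff_mem _).mpr hx

variable [IsNoetherianRing R] [IsLocalRing R]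

/-- Bass: for a finite module `N` over a Noetherian local ring whose `Ext^{n+1}` vanishes on finite
modules, the vanishing of `Ext^n` on finite modules can be tested on the residue field. -/
theorem subsingleton_ext_of_residueField (N : ModuleCat.{u} R) [Module.Finite R N] (n : ℕ)
    (hN : ∀ M : ModuleCat.{u} R, Module.Finite R M → Subsingleton (Ext M N (n + 1)))
    (hk : Subsingleton (Ext (ModuleCat.of R (R ⧸ maximalIdeal R)) N n))
    (M : Type u) [AddCommGroup M] [Module R M] [hM : Module.Finite R M] :
    Subsingleton (Ext (ModuleCat.of R M) N n) := by
  induction hM using IsNoetherianRing.induction_on_isQuotientEquivQuotientPrime R with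
  | subsingleton M =>
    have h0 : Limits.IsZero (ModuleCat.of R M) := ModuleCat.isZero_of_subsingleton _
    exact ⟨fun a b => by
      rw [← Ext.mk₀_id_comp a, ← Ext.mk₀_id_comp b, h0.eq_of_src (𝟙 _) 0]; simp⟩
  | quotient M P e =>
    suffices H : Subsingleton (Ext (ModuleCat.of R (R ⧸ P.1)) N n) by
      refine ⟨fun a b => ?_⟩
      have key : ∀ c : Ext (ModuleCat.of R M) N n, c = (Ext.mk₀ e.toModuleIso.hom).comp
          ((Ext.mk₀ e.toModuleIso.inv).comp c (zero_add n)) (zero_add n) := fun c => by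
        rw [Ext.mk₀_comp_mk₀_assoc, Iso.hom_inv_id, Ext.mk₀_id_comp]
      rw [key a, key b, H.elim ((Ext.mk₀ e.toModuleIso.inv).comp a _)
        ((Ext.mk₀ e.toModuleIso.inv).comp b _)]
    by_cases hP : P.1 = maximalIdeal R
    · rw [hP]; exact hk
    -- An element `y` of the maximal ideal outside `P` is regular on `R/P`. The vanishing of
    -- `Ext^{n+1}` on the quotient by `y` makes `y` surjective on `Ext^n`, and Nakayama applies.
    · obtain ⟨y, hym, hyP⟩ := Set.not_subset.mp fun h : (maximalIdeal R : Set R) ⊆ P.1 =>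
        hP (le_antisymm (le_maximalIdeal P.2.ne_top) h)
      have hreg : IsSMulRegular (ModuleCat.of R (R ⧸ P.1)) y := by
        refine isSMulRegular_iff_right_eq_zero_of_smul.mpr fun z hz => ?_
        obtain ⟨z, rfl⟩ := Ideal.Quotient.mk_surjective z
        have hz' : Ideal.Quotient.mk P.1 (y * z) = 0 := hz
        rw [Ideal.Quotient.eq_zero_iff_mem] at hz' ⊢
        exact (P.2.mem_or_mem hz').resolve_left hyP
      have := hN (ModuleCat.of R (QuotSMulTop y (ModuleCat.of R (R ⧸ P.1)))) inferInstance
      exact subsingleton_of_forall_exists_smul_eq hym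
        (exists_smul_eq_of_subsingleton_ext_quotSMulTop N hreg n)
  | exact M₁ M₂ M₃ f g hf hg hfg h₁ h₃ =>
    have hS : (ModuleCat.shortComplexOfCompEqZero f g hfg.linearMap_comp_eq_zero).ShortExact :=
      { exact := ModuleCat.shortComplex_exact _ hfg
        mono_f := (ModuleCat.mono_iff_injective _).mpr hf
        epi_g := (ModuleCat.epi_iff_surjective _).mpr hg }
    refine subsingleton_of_forall_eq 0 fun a => ?_
    obtain ⟨b, hb⟩ := Ext.contravariant_sequence_exact₂ hS N a (h₁.elim _ _)
    rw [← hb, h₃.elim b 0, Ext.comp_zero]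

/-- A Gorenstein local ring admits a regular sequence whose length `d` is at the same time the
injective dimension and the depth. -/
theorem IsGorensteinLocalRing.exists_isWeaklyRegular (R : Type u) [CommRing R]
    [IsGorensteinLocalRing R] :
    ∃ rs : List R, (∀ r ∈ rs, r ∈ maximalIdeal R) ∧ IsWeaklyRegular R rs ∧
      (∀ i, rs.length < i → ∀ M : ModuleCat.{u} R, Module.Finite R M →
        Subsingleton (Ext M (ModuleCat.of R R) i)) ∧
      ¬ Subsingleton (Ext (ModuleCat.of R (R ⧸ maximalIdeal R)) (ModuleCat.of R R) rs.length) := by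
  classical
  let k := ModuleCat.of R (R ⧸ maximalIdeal R)
  have hex : ∃ n, ∀ i, n ≤ i → ∀ M : ModuleCat.{u} R, Module.Finite R M →
      Subsingleton (Ext M (ModuleCat.of R R) i) := by
    obtain ⟨n, hn⟩ := IsGorensteinLocalRing.exists_hasInjectiveDimensionLE (R := R)
    exact ⟨n + 1, fun i hi M _ => HasInjectiveDimensionLT.subsingleton _ (n + 1) i hi M⟩
  have hspec := Nat.find_spec hex
  have hmin := fun m => Nat.find_min hex (m := m)
  generalize Nat.find hex = n at hspec hmin
  -- The least bound is positive because `Hom(R, R) ≠ 0`; after this split, `n` is the last degree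
  -- in which Ext does not vanish.
  obtain _ | n := n
  · have h := hspec 0 le_rfl (ModuleCat.of R R) inferInstance
    have h' : Subsingleton (R →ₗ[R] R) :=
      (Ext.addEquiv₀.trans (ModuleCat.homAddEquiv (M := ModuleCat.of R R)
        (N := ModuleCat.of R R))).symm.subsingleton
    exact absurd (LinearMap.congr_fun (h'.elim LinearMap.id 0) 1) one_ne_zero
  have hkn : ¬ Subsingleton (Ext k (ModuleCat.of R R) n) := fun hk =>
    hmin n n.lt_succ_self fun i hi M _ => by
      obtain rfl | hi := hi.eq_or_lt
      · exact subsingleton_ext_of_residueField _ n (hspec (n + 1) le_rfl) hk M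
      · exact hspec i hi M ‹_›
  have hex' : ∃ d, ¬ Subsingleton (Ext k (ModuleCat.of R R) d) := ⟨n, hkn⟩
  have hdspec := Nat.find_spec hex'
  have hdmin := fun m => Nat.find_min hex' (m := m)
  have hdn : Nat.find hex' ≤ n := Nat.find_min' hex' hkn
  generalize Nat.find hex' = d at hdspec hdmin hdn
  obtain ⟨rs, hlen, hmem, hreg⟩ := ModuleCat.exists_isRegular_of_exists_subsingleton_ext
    (maximalIdeal R) d (ModuleCat.of R R)
    (by simpa [lt_top_iff_ne_top] using Ideal.IsPrime.ne_top') k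
    (by rw [Module.support_eq_zeroLocus, Ideal.annihilator_quotient])
    fun i hi => not_not.mp (hdmin i hi)
  suffices hnd : n ≤ d by
    obtain rfl := le_antisymm hnd hdn
    exact ⟨rs, hmem, hreg.toIsWeaklyRegular, fun i hi => hspec i (by omega), by rwa [hlen]⟩
  -- If `d < n`, then `k` embeds in `R/(rs)`, which has projective dimension `d`. Since `Ext^{n+1}`
  -- vanishes, `Ext^n(k, R)` is a quotient of `Ext^n(R/(rs), R) = 0`, contradicting `hkn`.
  by_contra! hlt
  have hann : ∀ r ∈ rs, r ∈ Module.annihilator R k := fun r hr => by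
    rw [Ideal.annihilator_quotient]; exact hmem r hr
  obtain ⟨f, hf⟩ : ∃ f : k →ₗ[R] R ⧸ (Ideal.ofList rs • ⊤ : Submodule R R), f ≠ 0 := by
    by_contra! h
    exact hdspec (hlen ▸ subsingleton_ext_length k hreg.toIsWeaklyRegular hann
      (subsingleton_of_forall_eq 0 h))
  have : IsSimpleModule R k := isSimpleModule_iff_quot_maximal.mpr
    ⟨maximalIdeal R, inferInstance, ⟨LinearEquiv.refl _ _⟩⟩
  have hS := f.shortExact_mkQ_range (LinearMap.injective_of_ne_zero hf)
  have hpd : HasProjectiveDimensionLT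
      (ModuleCat.of R (R ⧸ (Ideal.ofList rs • ⊤ : Submodule R R))) (d + 1) := by
    rw [← projectiveDimension_lt_iff,
      ModuleCat.projectiveDimension_quotient_eq_add_length_of_isWeaklyRegular (ModuleCat.of R R) rs
        hreg.toIsWeaklyRegular hmem, ModuleCat.projectiveDimension_eq_zero_of_projective, zero_add,
      hlen]
    exact_mod_cast d.lt_succ_self
  refine hkn (subsingleton_of_forall_eq 0 fun α => ?_)
  obtain ⟨β, rfl⟩ := Ext.contravariant_sequence_exact₁ hS (ModuleCat.of R R) α
    (n₁ := n + 1) (add_comm 1 n) ((hspec (n + 1) le_rfl (ModuleCat.of R _) inferInstance).elim _ _)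
  exact (congrArg (fun γ => (Ext.mk₀ _).comp γ (zero_add n))
    (Ext.eq_zero_of_hasProjectiveDimensionLT β (d + 1) hlt)).trans (Ext.comp_zero _ _ _ _ _)

end InjectiveDimension

/-! ### Relative injectivity and socle of the quotient by a regular sequence. -/

section QuotientByRegularSequence

open CategoryTheory Abelian IsLocalRing RingTheory.Sequence

variable {R : Type u} [CommRing R]

theorem subsingleton_ext_of_lt_length (K : ModuleCat.{u} R) {N : Type u} [AddCommGroup N]
    [Module R N] {rs : List R} (hreg : IsWeaklyRegular N rs)
    (hK : ∀ r ∈ rs, r ∈ Module.annihilator R K) {i : ℕ} (hi : i < rs.length) :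
    Subsingleton (Ext K (ModuleCat.of R N) i) := by
  induction hreg generalizing i with
  | nil N => exact absurd hi (Nat.not_lt_zero i)
  | @cons N _ _ x rs hx _ ih =>
    have hxK := hK x List.mem_cons_self
    obtain _ | i := i
    · have : Subsingleton (K →ₗ[R] N) := subsingleton_of_forall_eq 0 fun φ =>
        LinearMap.ext fun m => (isSMulRegular_iff_right_eq_zero_of_smul.mp hx) _ <| by
          rw [← map_smul, Module.mem_annihilator.mp hxK, map_zero]
      exact (Ext.addEquiv₀.trans (ModuleCat.homAddEquiv (N := ModuleCat.of R N))).subsingleton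
    · exact subsingleton_ext_succ_of_quotSMulTop K (N := ModuleCat.of R N) hx hxK i
        (ih (fun r hr => hK r (List.mem_cons_of_mem _ hr)) (Nat.lt_of_succ_lt_succ hi))

/-- Compare the connecting maps from `Ext^j(-, N/xN)` to `Ext^{j+1}(-, N)`: at `M` it is surjective
because `x` kills `M`, and at `M'` it is injective because `Ext^j(M', N) = 0`. -/
theorem ext_precomp_surjective_of_succ {M' M N : ModuleCat.{u} R} (f : M' ⟶ M) {x : R}
    (hx : IsSMulRegular N x) (hM : x ∈ Module.annihilator R M) {j : ℕ}
    (h0 : Subsingleton (Ext M' N j))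
    (h : Function.Surjective ((Ext.mk₀ f).precomp N (zero_add (j + 1)))) :
    Function.Surjective
      ((Ext.mk₀ f).precomp (ModuleCat.of R (QuotSMulTop x N)) (zero_add j)) := by
  have hS := hx.smulShortComplex_shortExact
  change Function.Surjective ((Ext.mk₀ f).precomp (N.smulShortComplex x).X₃ (zero_add j))
  intro α
  obtain ⟨β, hβ⟩ := h (α.comp hS.extClass rfl)
  obtain ⟨γ, rfl⟩ := Ext.covariant_sequence_exact₁ M hS β (ext_comp_smul_id_eq_zero hM β) rfl
  refine ⟨γ, sub_eq_zero.mp ?_⟩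
  obtain ⟨δ, hδ⟩ := Ext.covariant_sequence_exact₃ M' hS
    ((Ext.mk₀ f).precomp (N.smulShortComplex x).X₃ (zero_add j) γ - α) rfl (by
      refine ((hS.extClass.postcomp M' rfl).map_sub _ _).trans (sub_eq_zero.mpr ?_)
      exact (Ext.comp_assoc _ _ _ (zero_add j) rfl (by omega)).trans hβ)
  exact hδ.symm.trans ((congrArg
    (fun ε : Ext M' N j => ε.comp (Ext.mk₀ (N.smulShortComplex x).g) (add_zero j)) (h0.elim δ (0 : Ext M' N j))).trans (Ext.zero_comp _ _ _ _ _))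

/-- Maps into `N ⧸ (rs)N` from modules killed by the weakly `N`-regular sequence `rs` of length `d`
extend along `f` as soon as classes in `Ext^d(-, N)` do. -/
theorem exists_comp_eq_of_ext_surjective {M' M : ModuleCat.{u} R} (f : M' ⟶ M)
    {N : Type u} [AddCommGroup N] [Module R N] {rs : List R} (hreg : IsWeaklyRegular N rs)
    (hM' : ∀ r ∈ rs, r ∈ Module.annihilator R M') (hM : ∀ r ∈ rs, r ∈ Module.annihilator R M)
    (h : Function.Surjective ((Ext.mk₀ f).precomp (ModuleCat.of R N) (zero_add rs.length)))
    (g : M' →ₗ[R] N ⧸ (Ideal.ofList rs • ⊤ : Submodule R N)) :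
    ∃ g' : M →ₗ[R] N ⧸ (Ideal.ofList rs • ⊤ : Submodule R N), g' ∘ₗ f.hom = g := by
  induction hreg with
  | nil N =>
    have e : (N ⧸ (Ideal.ofList ([] : List R) • ⊤ : Submodule R N)) ≃ₗ[R] N :=
      Submodule.quotEquivOfEqBot _ (by simp)
    obtain ⟨β, hβ⟩ := h (Ext.mk₀ (ModuleCat.ofHom (e.toLinearMap ∘ₗ g)))
    obtain ⟨β, rfl⟩ := (Ext.mk₀_bijective _ _).2 β
    have hβ' : f ≫ β = ModuleCat.ofHom (e.toLinearMap ∘ₗ g) :=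
      (Ext.mk₀_bijective _ _).1 ((Ext.mk₀_comp_mk₀ _ _).symm.trans hβ)
    refine ⟨e.symm.toLinearMap ∘ₗ β.hom, LinearMap.ext fun m => e.injective ?_⟩
    simpa using congrArg (fun φ => φ.hom m) hβ'
  | @cons N _ _ x rs hx hrs ih =>
    have hM'rs := fun r hr => hM' r (List.mem_cons_of_mem x hr)
    let e := Submodule.quotOfListConsSMulTopEquivQuotSMulTopInner N x rs
    obtain ⟨g', hg'⟩ := ih hM'rs (fun r hr => hM r (List.mem_cons_of_mem _ hr))
      (ext_precomp_surjective_of_succ f (N := ModuleCat.of R N) hx (hM x List.mem_cons_self)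
        (subsingleton_ext_of_lt_length M' (hrs.cons hx) hM' (Nat.lt_succ_self _)) h)
      (e.toLinearMap ∘ₗ g)
    refine ⟨e.symm.toLinearMap ∘ₗ g', ?_⟩
    rw [LinearMap.comp_assoc, hg', ← LinearMap.comp_assoc]
    simp

/-- `A` behaves as an injective module with respect to the finite modules killed by `I`. -/
def Ideal.IsInjectiveModulo (I : Ideal R) (A : Type u) [AddCommGroup A] [Module R A] : Prop :=
  ∀ ⦃M' M : Type u⦄ [AddCommGroup M'] [Module R M'] [AddCommGroup M] [Module R M]
    [Module.Finite R M'] [Module.Finite R M] (f : M' →ₗ[R] M),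
    Function.Injective f → I ≤ Module.annihilator R M' → I ≤ Module.annihilator R M →
    ∀ g : M' →ₗ[R] A, ∃ g' : M →ₗ[R] A, g' ∘ₗ f = g

/-- The obstruction to extending classes of `Ext^d` along an injection lies in `Ext^{d+1}` of its
cokernel, which vanishes; extension of classes then descends to homomorphisms into the quotient by
`rs`. -/
theorem Ideal.isInjectiveModulo_ofList {rs : List R} (hreg : IsWeaklyRegular R rs)
    (h : ∀ M : ModuleCat.{u} R, Module.Finite R M →
      Subsingleton (Ext M (ModuleCat.of R R) (rs.length + 1))) :
    (Ideal.ofList rs).IsInjectiveModulo (R ⧸ (Ideal.ofList rs • ⊤ : Submodule R R)) := by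
  intro M' M _ _ _ _ _ _ f hf hM' hM g
  have mem : ∀ r ∈ rs, r ∈ Ideal.ofList rs := fun r hr => Ideal.subset_span hr
  refine exists_comp_eq_of_ext_surjective (ModuleCat.ofHom f) hreg (fun r hr => hM' (mem r hr))
    (fun r hr => hM (mem r hr)) (fun α => ?_) g
  exact Ext.contravariant_sequence_exact₁ (f.shortExact_mkQ_range hf) (ModuleCat.of R R) α
    (n₁ := rs.length + 1) (add_comm 1 _) ((h (ModuleCat.of R _) inferInstance).elim _ _)

variable [IsLocalRing R] {I : Ideal R}

/-- The cyclic module `R ⧸ I` has simple socle if it is injective modulo `I`. -/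
theorem Ideal.IsInjectiveModulo.exists_smul_eq {A : Type u} [AddCommGroup A] [Module R A]
    (hA : I.IsInjectiveModulo A) {a : A} (ha : Submodule.span R {a} = ⊤)
    (hI : I ≤ Module.annihilator R A) {t z : A} (ht : t ≠ 0)
    (hmt : ∀ r ∈ maximalIdeal R, r • t = 0) (hmz : ∀ r ∈ maximalIdeal R, r • z = 0) :
    ∃ r : R, r • t = z := by
  have liftm : ∀ z : A, (∀ r ∈ maximalIdeal R, r • z = 0) →
      ∃ g : (R ⧸ maximalIdeal R) →ₗ[R] A, g (Ideal.Quotient.mk _ 1) = z := fun z hz =>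
    ⟨Submodule.liftQ _ (LinearMap.toSpanSingleton R A z) (fun r hr => by simpa using hz r hr),
      one_smul R z⟩
  obtain ⟨f, hf⟩ := liftm t hmt
  obtain ⟨g, hg⟩ := liftm z hmz
  have : IsSimpleModule R (R ⧸ maximalIdeal R) := isSimpleModule_iff_quot_maximal.mpr
    ⟨maximalIdeal R, inferInstance, ⟨LinearEquiv.refl _ _⟩⟩
  have hfinj : Function.Injective f :=
    LinearMap.injective_of_ne_zero fun h0 => ht (by rw [← hf, h0, LinearMap.zero_apply])
  have hIm : I ≤ maximalIdeal R := fun r hr => by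
    by_contra hu
    have hu : IsUnit r := by simpa using hu
    exact ht (hu.smul_eq_zero.mp (Module.mem_annihilator.mp (hI hr) t))
  have : Module.Finite R A := ⟨⟨{a}, by simpa using ha⟩⟩
  -- Both `t` and `z` are images of `1` under maps from the residue field. Extending the second
  -- along the first gives an endomorphism of the cyclic module `A`, hence multiplication by a
  -- scalar `c`.
  obtain ⟨ψ, hψ⟩ := hA f hfinj (by rwa [Ideal.annihilator_quotient]) hI g
  obtain ⟨c, hc⟩ := Submodule.mem_span_singleton.mp (ha ▸ Submodule.mem_top (x := ψ a))
  obtain ⟨r, hr⟩ := Submodule.mem_span_singleton.mp (ha ▸ Submodule.mem_top (x := t))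
  refine ⟨c, ?_⟩
  rw [← hg, ← hψ, LinearMap.comp_apply, hf, ← hr, map_smul, ← hc, smul_comm]


/-- If `A` has a nonzero element killed by the maximal ideal, then homomorphisms to `A` separate the
elements of a finite module killed by `I`. -/
theorem Ideal.IsInjectiveModulo.exists_apply_ne_zero {A : Type u} [AddCommGroup A] [Module R A]
    (hA : I.IsInjectiveModulo A) {t : A} (ht : t ≠ 0) (hmt : ∀ r ∈ maximalIdeal R, r • t = 0)
    {M : Type u} [AddCommGroup M] [Module R M] [Module.Finite R M]
    (hI : I ≤ Module.annihilator R M) {b : M} (hb : b ≠ 0) : ∃ φ : M →ₗ[R] A, φ b ≠ 0 := by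
  let K := LinearMap.ker (LinearMap.toSpanSingleton R M b)
  have hK : K ≤ maximalIdeal R := fun r hr => by
    by_contra hu
    have hu : IsUnit r := by simpa using hu
    exact hb (hu.smul_eq_zero.mp (by simpa [K] using hr))
  -- Since `Ann(b)` lies in the maximal ideal, `b ↦ t` is well defined on `Rb ≅ R/Ann(b)`; extend it
  -- to `M`.
  obtain ⟨φ, hφ⟩ := hA (Submodule.liftQ K (LinearMap.toSpanSingleton R M b) le_rfl)
    (LinearMap.ker_eq_bot.mp (Submodule.ker_liftQ_eq_bot _ _ _ le_rfl))
    (fun r hr => by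
      rw [Ideal.annihilator_quotient]
      simpa [K] using Module.mem_annihilator.mp (hI hr) b) hI
    (Submodule.liftQ K (LinearMap.toSpanSingleton R A t) fun r hr => by simpa using hmt r (hK hr))
  refine ⟨φ, fun h0 => ht ?_⟩
  have h1 : φ ((1 : R) • b) = (1 : R) • t := LinearMap.congr_fun hφ (Submodule.Quotient.mk 1)
  rw [← one_smul R t, ← h1, one_smul, h0]

end QuotientByRegularSequence

/-! ### Generating the dual of a finite local algebra. -/

section Dual

open IsLocalRing

/-- Over a finite field extension `L` of `K`, the `K`-dual of `L` is generated as an `L`-vector space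
by any nonzero functional. -/
theorem LinearMap.exists_eq_apply_mul_of_field {K L : Type*} [Field K] [Field L] [Algebra K L]
    [FiniteDimensional K L] {f : L →ₗ[K] K} (hf : f ≠ 0) (g : L →ₗ[K] K) :
    ∃ l : L, ∀ x, g x = f (l * x) := by
  let T : L →ₗ[K] (L →ₗ[K] K) := (LinearMap.compRight K f) ∘ₗ LinearMap.mul K L
  have hT : Function.Injective T := (injective_iff_map_eq_zero T).mpr fun l hl => by
    by_contra hl0
    refine hf (LinearMap.ext fun x => ?_)
    have := LinearMap.congr_fun hl (l⁻¹ * x)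
    simpa [T, mul_inv_cancel_left₀ hl0] using this
  obtain ⟨l, hl⟩ := (LinearMap.injective_iff_surjective_of_finrank_eq_finrank
    (Subspace.dual_finrank_eq (K := K) (V := L)).symm).mp hT g
  exact ⟨l, fun x => by rw [← hl]; rfl⟩

variable {R S : Type u} [CommRing R] [CommRing S] [Algebra R S]

/-- The `S`-module structure on `Hom_R(S, A)` by premultiplication. -/
abbrev LinearMap.premulModule (R S : Type*) [CommRing R] [CommRing S] [Algebra R S] (A : Type*)
    [AddCommGroup A] [Module R A] : Module S (S →ₗ[R] A) where
  smul s φ := φ ∘ₗ LinearMap.mulLeft R s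
  one_smul φ := LinearMap.ext fun x => congrArg φ (one_mul x)
  mul_smul s t φ := LinearMap.ext fun x => congrArg φ (by
    change s * t * x = t * (s * x)
    ring)
  smul_zero _ := rfl
  smul_add _ _ _ := rfl
  add_smul s t φ := LinearMap.ext fun x =>
    (congrArg φ (add_mul s t x)).trans (map_add φ (s * x) (t * x))
  zero_smul φ := LinearMap.ext fun x => (congrArg φ (zero_mul x)).trans (map_zero φ)

variable [IsLocalRing R] [IsLocalRing S] [IsLocalHom (algebraMap R S)] [Module.Finite R S]
  {A : Type u} [AddCommGroup A] [Module R A]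

/-- Functionals on `S ⧸ mₛ` with values in a copy of the residue field of `R`. -/
theorem exists_eq_apply_mul_of_maximalIdeal {t : A} (ht : t ≠ 0)
    (hmt : ∀ r ∈ maximalIdeal R, r • t = 0)
    {f g : S →ₗ[R] A} (hf0 : f ≠ 0) (hf : ∀ s ∈ maximalIdeal S, f s = 0)
    (hg : ∀ s ∈ maximalIdeal S, g s = 0) (hft : ∀ s, f s ∈ Submodule.span R {t})
    (hgt : ∀ s, g s ∈ Submodule.span R {t}) : ∃ l : S, ∀ x, g x = f (l * x) := by
  let e : ResidueField R →ₗ[R] A := Submodule.liftQ _ (LinearMap.toSpanSingleton R A t)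
    (fun r hr => by simpa using hmt r hr)
  have he : ∀ r, e (residue R r) = r • t := fun r => rfl
  have heinj : Function.Injective e := by
    refine (injective_iff_map_eq_zero e).mpr fun z hz => ?_
    obtain ⟨r, rfl⟩ := residue_surjective z
    by_contra hr
    have hu : IsUnit r := by simpa using hr
    exact ht (hu.smul_eq_zero.mp hz)
  have key : ∀ h : S →ₗ[R] A, (∀ s ∈ maximalIdeal S, h s = 0) →
      (∀ s, h s ∈ Submodule.span R {t}) →
      ∃ h' : ResidueField S →ₗ[ResidueField R] ResidueField R,
        ∀ s, e (h' (residue S s)) = h s := by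
    intro h hm ht
    have hrange : ∀ s, h s ∈ LinearMap.range e := fun s => by
      obtain ⟨r, hr⟩ := Submodule.mem_span_singleton.mp (ht s)
      exact ⟨residue R r, hr⟩
    let e' := LinearEquiv.ofInjective e heinj
    let h₀ : S →ₗ[R] ResidueField R := e'.symm.toLinearMap ∘ₗ h.codRestrict _ hrange
    have h₀e : ∀ s, e (h₀ s) = h s := fun s =>
      congrArg Subtype.val (e'.apply_symm_apply ⟨h s, hrange s⟩)
    let h₁ : ResidueField S →ₗ[R] ResidueField R :=
      Submodule.liftQ ((maximalIdeal S).restrictScalars R) h₀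
        (fun s hs => heinj (by rw [h₀e, hm s hs, map_zero]))
    exact ⟨h₁.extendScalarsOfSurjective residue_surjective, h₀e⟩
  obtain ⟨f', hf'⟩ := key f hf hft
  obtain ⟨g', hg'⟩ := key g hg hgt
  obtain ⟨l, hl⟩ := LinearMap.exists_eq_apply_mul_of_field (f := f')
    (fun h0 => hf0 (LinearMap.ext fun s => by rw [← hf', h0]; simp)) g'
  obtain ⟨l, rfl⟩ := residue_surjective l
  exact ⟨l, fun x => by rw [← hg', hl, ← map_mul, hf']⟩

variable [IsNoetherianRing R] [IsNoetherianRing S] {I : Ideal R}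

/-- Here `t` spans the socle of `A` and `σ` that of `S/IS`. Modulo `mₛ • Hom`, a functional is
determined by its restriction to the socle, where duality for the residue field extension applies;
so any `Ψ` with `Ψ σ ≠ 0` generates, by Nakayama. -/
theorem exists_generator_of_isInjectiveModulo (hA : I.IsInjectiveModulo A) [Module.Finite R A]
    (hI : I ≤ Module.annihilator R A) {t : A} (ht : t ≠ 0)
    (hmt : ∀ r ∈ maximalIdeal R, r • t = 0)
    (hsoc : ∀ z : A, (∀ r ∈ maximalIdeal R, r • z = 0) → ∃ r : R, r • t = z)
    {σ : S} (hσ : σ ∉ I.map (algebraMap R S))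
    (hmσ : ∀ s ∈ maximalIdeal S, s * σ ∈ I.map (algebraMap R S))
    (hsocS : ∀ z : S, (∀ s ∈ maximalIdeal S, s * z ∈ I.map (algebraMap R S)) →
      ∃ s : S, z - s * σ ∈ I.map (algebraMap R S)) :
    ∃ Ψ : S →ₗ[R] A, (∀ φ : S →ₗ[R] A, ∃ s, ∀ x, φ x = Ψ (s * x)) ∧
      ∀ s, (∀ x, Ψ (s * x) = 0) → s ∈ I.map (algebraMap R S) := by
  let IS := I.map (algebraMap R S)
  have hIS : ∀ φ : S →ₗ[R] A, ∀ s ∈ IS, φ s = 0 := fun φ s hs => by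
    rw [← Submodule.restrictScalars_mem R, ← Ideal.smul_top_eq_map] at hs
    refine Submodule.smul_induction_on hs (fun r hr n _ => ?_) fun x y hx hy => ?_
    · rw [map_smul, Module.mem_annihilator.mp (hI hr)]
    · rw [map_add, hx, hy, add_zero]
  have hkill : ∀ (J : Ideal S), IS ≤ J → I ≤ Module.annihilator R (S ⧸ J) := fun J hJ r hr =>
    Module.mem_annihilator.mpr fun z => by
      obtain ⟨z, rfl⟩ := Ideal.Quotient.mk_surjective z
      rw [Algebra.smul_def, IsScalarTower.algebraMap_apply R S (S ⧸ J),
        Ideal.Quotient.algebraMap_eq, ← map_mul, Ideal.Quotient.eq_zero_iff_mem]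
      exact J.mul_mem_right _ (hJ (Ideal.mem_map_of_mem _ hr))
  have hsep : ∀ s ∉ IS, ∃ φ : S →ₗ[R] A, φ s ≠ 0 := fun s hs => by
    obtain ⟨φ, hφ⟩ := hA.exists_apply_ne_zero ht hmt (hkill IS le_rfl)
      (b := Ideal.Quotient.mk IS s) (by rwa [Ne, Ideal.Quotient.eq_zero_iff_mem])
    exact ⟨φ ∘ₗ (Ideal.Quotient.mkₐ R IS).toLinearMap, hφ⟩
  obtain ⟨Ψ, hΨ⟩ := hsep σ hσ
  -- An element annihilating a generator annihilates every functional, and functionals separate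
  -- points modulo `IS`.
  suffices hgen : ∀ φ : S →ₗ[R] A, ∃ s, ∀ x, φ x = Ψ (s * x) by
    refine ⟨Ψ, hgen, fun s hs => ?_⟩
    by_contra hs'
    obtain ⟨φ, hφ⟩ := hsep s hs'
    obtain ⟨a, ha⟩ := hgen φ
    exact hφ (by rw [ha, mul_comm, hs])
  let _ := LinearMap.premulModule R S A
  have hsmul : ∀ (s : S) (φ : S →ₗ[R] A) x, (s • φ) x = φ (s * x) := fun _ _ _ => rfl
  have : IsScalarTower R S (S →ₗ[R] A) := ⟨fun r s φ => LinearMap.ext fun x => by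
    rw [hsmul, LinearMap.smul_apply, hsmul, smul_mul_assoc, map_smul]⟩
  have : Module.Finite S (S →ₗ[R] A) := Module.Finite.of_restrictScalars_finite R S _
  have hσsoc : ∀ φ : S →ₗ[R] A, (∀ s ∈ maximalIdeal S, (σ • φ) s = 0) ∧
      ∀ s, (σ • φ) s ∈ Submodule.span R {t} := fun φ => by
    have h1 : ∀ s ∈ maximalIdeal S, (σ • φ) s = 0 := fun s hs => by
      rw [hsmul, mul_comm]; exact hIS _ _ (hmσ s hs)
    refine ⟨h1, fun s => Submodule.mem_span_singleton.mpr (hsoc _ fun r hr => ?_)⟩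
    rw [← map_smul]
    refine h1 _ ?_
    rw [Algebra.smul_def]
    exact Ideal.mul_mem_right _ _ (map_nonunit (algebraMap R S) r hr)
  -- maps vanishing on the socle of `S ⧸ IS` lie in `mₛ • Hom`
  have hvanish : ∀ φ : S →ₗ[R] A, (∀ s, φ (s * σ) = 0) →
      φ ∈ maximalIdeal S • (⊤ : Submodule S (S →ₗ[R] A)) := by
    intro φ hφ
    obtain ⟨n, g, hg⟩ := Submodule.fg_iff_exists_fin_generating_family.mp
      (IsNoetherian.noetherian (maximalIdeal S))
    have hgm : ∀ i, g i ∈ maximalIdeal S := fun i => hg ▸ Submodule.subset_span ⟨i, rfl⟩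
    let J := IS ⊔ Ideal.span {σ}
    have hJ : ∀ z ∈ J, ∀ s ∈ maximalIdeal S, s * z ∈ IS := fun z hz s hs => by
      obtain ⟨a, ha, b, hb, rfl⟩ := Submodule.mem_sup.mp hz
      obtain ⟨b, rfl⟩ := Ideal.mem_span_singleton'.mp hb
      rw [mul_add, mul_left_comm]
      exact IS.add_mem (IS.mul_mem_left _ ha) (IS.mul_mem_left _ (hmσ s hs))
    -- Multiplication by generators `g i` of the maximal ideal embeds `S/J` in a power of `S/IS`, as
    -- its kernel on `S/IS` is the socle. Extending `φ` along this embedding writes it as a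
    -- combination of functionals with coefficients `g i`.
    let f : (S ⧸ J) →ₗ[R] (Fin n → S ⧸ IS) := LinearMap.pi fun i =>
      (Submodule.liftQ J (IS.mkQ ∘ₗ LinearMap.mulLeft S (g i)) fun z hz => by
        simpa using Ideal.Quotient.eq_zero_iff_mem.mpr (hJ z hz _ (hgm i))).restrictScalars R
    have hf : ∀ z i, f (Ideal.Quotient.mk J z) i = Ideal.Quotient.mk IS (g i * z) :=
      fun z i => rfl
    have hfinj : Function.Injective f := by
      refine (injective_iff_map_eq_zero f).mpr fun z hz => ?_
      obtain ⟨z, rfl⟩ := Ideal.Quotient.mk_surjective z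
      obtain ⟨s, hs⟩ := hsocS z fun s hs => by
        rw [← hg] at hs
        refine Submodule.span_induction ?_ ?_ ?_ ?_ hs
        · rintro _ ⟨i, rfl⟩
          rw [← Ideal.Quotient.eq_zero_iff_mem, ← hf, hz, Pi.zero_apply]
        · simp
        · intro x y _ _ hx hy
          rw [add_mul]; exact Ideal.add_mem _ hx hy
        · intro a x _ hx
          rw [smul_eq_mul, mul_assoc]; exact Ideal.mul_mem_left _ _ hx
      rw [Ideal.Quotient.eq_zero_iff_mem, ← sub_add_cancel z (s * σ)]
      exact Submodule.add_mem_sup hs (Ideal.mem_span_singleton'.mpr ⟨s, rfl⟩)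
    have hφJ : J.restrictScalars R ≤ LinearMap.ker φ := fun z hz => by
      obtain ⟨a, ha, b, hb, rfl⟩ := Submodule.mem_sup.mp hz
      obtain ⟨b, rfl⟩ := Ideal.mem_span_singleton'.mp hb
      rw [LinearMap.mem_ker, map_add, hIS φ a ha, hφ, add_zero]
    obtain ⟨ψ, hψ⟩ := hA f hfinj (hkill J le_sup_left) (fun r hr =>
      Module.mem_annihilator.mpr fun v => funext fun i =>
        Module.mem_annihilator.mp (hkill IS le_rfl hr) (v i))
      (Submodule.liftQ (J.restrictScalars R) φ hφJ)
    have hsum : φ = ∑ i, g i • (ψ ∘ₗ LinearMap.single R (fun _ : Fin n => S ⧸ IS) i ∘ₗ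
        (Ideal.Quotient.mkₐ R IS).toLinearMap) := by
      ext x
      have h1 : φ x = ψ (f (Ideal.Quotient.mk J x)) :=
        (LinearMap.congr_fun hψ (Ideal.Quotient.mk J x)).symm
      rw [h1, LinearMap.sum_apply, ← LinearMap.sum_single_apply _ (f (Ideal.Quotient.mk J x)),
        map_sum]
      rfl
    rw [hsum]
    exact Submodule.sum_mem _ fun i _ => Submodule.smul_mem_smul (hgm i) trivial
  have htop : (⊤ : Submodule S (S →ₗ[R] A)) ≤ Submodule.span S {Ψ} := by
    refine Submodule.le_of_le_smul_of_le_jacobson_bot (I := maximalIdeal S) Module.Finite.fg_top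
      (IsLocalRing.jacobson_eq_maximalIdeal ⊥ bot_ne_top).ge fun φ _ => ?_
    -- Choose `l` so that `φ - l • Ψ` vanishes on the socle.
    obtain ⟨l, hl⟩ := exists_eq_apply_mul_of_maximalIdeal ht hmt (f := σ • Ψ) (g := σ • φ)
      (fun h0 => hΨ (by rw [← mul_one σ, ← hsmul, h0, LinearMap.zero_apply]))
      (hσsoc Ψ).1 (hσsoc φ).1 (hσsoc Ψ).2 (hσsoc φ).2
    rw [← add_sub_cancel (l • Ψ) φ]
    refine Submodule.add_mem_sup (Submodule.smul_mem _ _ (Submodule.mem_span_singleton_self _))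
      (hvanish _ fun s => ?_)
    have := hl s
    rw [hsmul, hsmul] at this
    rw [LinearMap.sub_apply, hsmul, mul_comm s, this, mul_left_comm, sub_self]
  intro φ
  obtain ⟨s, hs⟩ := Submodule.mem_span_singleton.mp (htop (Submodule.mem_top (x := φ)))
  exact ⟨s, fun x => by rw [← hs, hsmul]⟩

end Dual

/-! ### Lifting a generator along a regular sequence. -/

section Lifting

open CategoryTheory Abelian IsLocalRing RingTheory.Sequence
open scoped Pointwise

variable {R : Type u} [CommRing R]

theorem subsingleton_ext_quotSMulTop (K : ModuleCat.{u} R) {N : ModuleCat.{u} R} {x : R}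
    (hx : IsSMulRegular N x) {j : ℕ} (h : Subsingleton (Ext K N j))
    (h' : Subsingleton (Ext K N (j + 1))) :
    Subsingleton (Ext K (ModuleCat.of R (QuotSMulTop x N)) j) := by
  refine subsingleton_of_forall_eq 0 fun α => ?_
  obtain ⟨β, hβ⟩ := Ext.covariant_sequence_exact₃ K hx.smulShortComplex_shortExact
    (α : Ext K (N.smulShortComplex x).X₃ j) rfl (h'.elim _ _)
  exact hβ.symm.trans ((congrArg (fun ε : Ext K N j =>
    ε.comp (Ext.mk₀ (N.smulShortComplex x).g) (add_zero j)) (h.elim β 0)).trans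
      (Ext.zero_comp _ _ _ _ _))

theorem exists_mkQ_comp_eq_of_subsingleton_ext {K N : Type u} [AddCommGroup K] [Module R K]
    [AddCommGroup N] [Module R N] {x : R} (hx : IsSMulRegular N x)
    (h : Subsingleton (Ext (ModuleCat.of R K) (ModuleCat.of R N) 1))
    (φ : K →ₗ[R] QuotSMulTop x N) :
    ∃ φ' : K →ₗ[R] N, (x • (⊤ : Submodule R N)).mkQ ∘ₗ φ' = φ := by
  have hx' : IsSMulRegular (ModuleCat.of R N) x := hx
  obtain ⟨β, hβ⟩ := Ext.covariant_sequence_exact₃ (ModuleCat.of R K)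
    hx'.smulShortComplex_shortExact (Ext.mk₀ (ModuleCat.ofHom φ)) (zero_add 1) (h.elim _ _)
  obtain ⟨β, rfl⟩ := (Ext.mk₀_bijective _ _).2 β
  have hβ' := (Ext.mk₀_bijective _ _).1 ((Ext.mk₀_comp_mk₀ _ _).symm.trans hβ)
  exact ⟨β.hom, congrArg ModuleCat.Hom.hom hβ'⟩

theorem exists_eq_smul_of_mkQ_comp_eq_zero {K N : Type*} [AddCommGroup K] [Module R K]
    [AddCommGroup N] [Module R N] {x : R} (hx : IsSMulRegular N x) {φ : K →ₗ[R] N}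
    (h : (x • (⊤ : Submodule R N)).mkQ ∘ₗ φ = 0) : ∃ φ' : K →ₗ[R] N, x • φ' = φ := by
  have hrange : ∀ k, φ k ∈ LinearMap.range (LinearMap.lsmul R N x) := fun k => by
    have hk : φ k ∈ x • (⊤ : Submodule R N) :=
      (Submodule.Quotient.mk_eq_zero _).mp (LinearMap.congr_fun h k)
    obtain ⟨n, -, hn⟩ := hk
    exact ⟨n, hn⟩
  let e := LinearEquiv.ofInjective (LinearMap.lsmul R N x) hx
  refine ⟨e.symm.toLinearMap ∘ₗ φ.codRestrict _ hrange, LinearMap.ext fun k => ?_⟩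
  exact congrArg Subtype.val (e.apply_symm_apply ⟨φ k, hrange k⟩)

variable [IsLocalRing R] [IsNoetherianRing R]

/-- Each `M`-regular element lowers the vanishing bound by one: `Ext^{i+1}(M/xM, N) = 0` makes `x`
surjective on `Ext^i(M, N)`, which is finite, so Nakayama kills it. -/
theorem subsingleton_ext_of_isWeaklyRegular (N : ModuleCat.{u} R) [Module.Finite R N] {d : ℕ}
    (hd : ∀ i, d < i → ∀ M : ModuleCat.{u} R, Module.Finite R M → Subsingleton (Ext M N i))
    {M : Type u} [AddCommGroup M] [Module R M] [Module.Finite R M] {rs : List R}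
    (hrs : ∀ r ∈ rs, r ∈ maximalIdeal R) (hreg : IsWeaklyRegular M rs) {i : ℕ}
    (hi : d < i + rs.length) : Subsingleton (Ext (ModuleCat.of R M) N i) := by
  induction rs generalizing M i with
  | nil => exact hd i hi (ModuleCat.of R M) inferInstance
  | cons x rs ih =>
    obtain ⟨hx, hreg⟩ := (isWeaklyRegular_cons_iff M x rs).mp hreg
    have := ih (fun r hr => hrs r (List.mem_cons_of_mem _ hr)) hreg (i := i + 1)
      (by simp only [List.length_cons] at hi; omega)
    exact subsingleton_of_forall_exists_smul_eq (hrs x List.mem_cons_self)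
      (exists_smul_eq_of_subsingleton_ext_quotSMulTop (M := ModuleCat.of R M) N hx i)

variable {S : Type u} [CommRing S] [Algebra R S] [Module.Finite R S]

/-- A generator of `Hom_R(S, N)` over `S` is obtained from one of `Hom_R(S, N ⧸ (rs)N)`, if `rs` is
weakly `N`-regular and `Ext^j_R(S, N)` vanishes for all `j > 0`. -/
theorem exists_generator_of_quotient {N : Type u} [AddCommGroup N] [Module R N]
    [Module.Finite R N] {rs : List R} (hrs : ∀ r ∈ rs, r ∈ maximalIdeal R)
    (hreg : IsWeaklyRegular N rs)
    (hExt : ∀ j, Subsingleton (Ext (ModuleCat.of R S) (ModuleCat.of R N) (j + 1)))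
    (J : Ideal S) (hJ : ∀ φ : S →ₗ[R] N, ∀ s ∈ J, φ s = 0)
    (h : ∃ Ψ : S →ₗ[R] N ⧸ (Ideal.ofList rs • ⊤ : Submodule R N),
      (∀ φ : S →ₗ[R] N ⧸ (Ideal.ofList rs • ⊤ : Submodule R N), ∃ s, ∀ y, φ y = Ψ (s * y)) ∧
      ∀ s, (∀ y, Ψ (s * y) = 0) → s ∈ J ⊔ (Ideal.ofList rs).map (algebraMap R S)) :
    ∃ Ψ : S →ₗ[R] N, (∀ φ : S →ₗ[R] N, ∃ s, ∀ y, φ y = Ψ (s * y)) ∧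
      ∀ s, (∀ y, Ψ (s * y) = 0) → s ∈ J := by
  induction rs generalizing N J with
  | nil =>
    have e : (N ⧸ (Ideal.ofList ([] : List R) • ⊤ : Submodule R N)) ≃ₗ[R] N :=
      Submodule.quotEquivOfEqBot _ (by simp)
    obtain ⟨Ψ, hgen, hann⟩ := h
    refine ⟨e.toLinearMap ∘ₗ Ψ, fun φ => ?_, fun s hs => ?_⟩
    · obtain ⟨s, hs⟩ := hgen (e.symm.toLinearMap ∘ₗ φ)
      exact ⟨s, fun y => e.symm.injective (by simpa using hs y)⟩
    · simpa using hann s fun y => e.injective (by simpa using hs y)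
  | cons x rs ih =>
    obtain ⟨hx, hreg⟩ := (isWeaklyRegular_cons_iff N x rs).mp hreg
    have hxm := hrs x List.mem_cons_self
    have hjac : Ideal.span {x} ≤ (⊥ : Ideal R).jacobson := by
      rw [IsLocalRing.jacobson_eq_maximalIdeal ⊥ bot_ne_top]
      exact (Ideal.span_singleton_le_iff_mem _).mpr hxm
    let q := (x • (⊤ : Submodule R N)).mkQ
    have hlift := exists_mkQ_comp_eq_of_subsingleton_ext (K := S) hx (hExt 0)
    -- The ideal `J` is kept general because it becomes `J + xS` when `N` is replaced by `N/xN`.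
    obtain ⟨Ψ', hgen', hann'⟩ := ih (N := QuotSMulTop x N)
      (fun r hr => hrs r (List.mem_cons_of_mem _ hr)) hreg
      (fun j => subsingleton_ext_quotSMulTop (ModuleCat.of R S) (N := ModuleCat.of R N) hx
        (hExt j) (hExt (j + 1)))
      (J ⊔ Ideal.span {algebraMap R S x}) (fun φ s hs => by
        obtain ⟨φ, rfl⟩ := hlift φ
        obtain ⟨a, ha, b, hb, rfl⟩ := Submodule.mem_sup.mp hs
        obtain ⟨b, rfl⟩ := Ideal.mem_span_singleton'.mp hb
        rw [mul_comm, ← Algebra.smul_def, LinearMap.comp_apply, map_add, hJ φ a ha, zero_add,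
          map_smul]
        exact (Submodule.Quotient.mk_eq_zero _).mpr
          (Submodule.smul_mem_pointwise_smul _ _ _ trivial)) (by
        obtain ⟨Ψ, hgen, hann⟩ := h
        let e := Submodule.quotOfListConsSMulTopEquivQuotSMulTopInner N x rs
        refine ⟨e.toLinearMap ∘ₗ Ψ, fun φ => ?_, fun s hs => ?_⟩
        · obtain ⟨s, hs⟩ := hgen (e.symm.toLinearMap ∘ₗ φ)
          exact ⟨s, fun y => e.symm.injective (by simpa using hs y)⟩
        · have := hann s fun y => e.injective (by simpa using hs y)
          rwa [Ideal.ofList_cons, Ideal.map_sup, Ideal.map_span, Set.image_singleton,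
            ← sup_assoc] at this)
    obtain ⟨Ψ, rfl⟩ := hlift Ψ'
    let T : S →ₗ[R] (S →ₗ[R] N) := (LinearMap.compRight R Ψ) ∘ₗ LinearMap.mul R S
    have hT : ∀ s y, T s y = Ψ (s * y) := fun _ _ => rfl
    refine ⟨Ψ, fun φ => ?_, fun s hs => ?_⟩
    -- A map agreeing with a multiple of `Ψ` modulo `x` differs from it by `x` times a map; Nakayama
    -- finishes.
    · have htop : (⊤ : Submodule R (S →ₗ[R] N)) ≤ LinearMap.range T := by
        refine Submodule.le_of_le_smul_of_le_jacobson_bot (I := Ideal.span {x})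
          Module.Finite.fg_top hjac fun φ _ => ?_
        obtain ⟨s, hs⟩ := hgen' (q ∘ₗ φ)
        obtain ⟨φ', hφ'⟩ := exists_eq_smul_of_mkQ_comp_eq_zero hx (φ := φ - T s)
          (LinearMap.ext fun y => by
            rw [LinearMap.comp_apply, LinearMap.sub_apply, map_sub, hT]
            exact sub_eq_zero.mpr (hs y))
        rw [← add_sub_cancel (T s) φ, ← hφ']
        exact Submodule.add_mem_sup ⟨s, rfl⟩
          (Submodule.smul_mem_smul (Ideal.mem_span_singleton_self x) trivial)
      obtain ⟨s, rfl⟩ := htop (Submodule.mem_top (x := φ))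
      exact ⟨s, hT s⟩
    -- If `a + xb` kills `Ψ` with `a ∈ J`, then regularity of `x` makes `b` kill `Ψ`. Thus `ker T ≤
    -- J + x ker T`, and Nakayama applies again.
    · have hker : LinearMap.ker T ≤ J.restrictScalars R := by
        refine Submodule.le_of_le_smul_of_le_jacobson_bot (I := Ideal.span {x})
          (IsNoetherian.noetherian _) hjac fun s hs => ?_
        have hs : ∀ y, Ψ (s * y) = 0 := LinearMap.congr_fun hs
        obtain ⟨a, ha, b, hb, rfl⟩ := Submodule.mem_sup.mp (hann' s fun y => by
          rw [LinearMap.comp_apply, hs, map_zero])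
        obtain ⟨b, rfl⟩ := Ideal.mem_span_singleton'.mp hb
        rw [mul_comm, ← Algebra.smul_def] at hs ⊢
        refine Submodule.add_mem_sup ha (Submodule.smul_mem_smul (Ideal.mem_span_singleton_self x)
          (LinearMap.ext fun y => hx ?_))
        have := hs y
        rw [add_mul, map_add, hJ Ψ _ (J.mul_mem_right y ha), zero_add, smul_mul_assoc,
          map_smul] at this
        simpa [hT] using this
      exact hker (LinearMap.ext hs)

end Lifting

/-! ### The Frobenius trace and compatible ideals. -/

section Frobenius

open CategoryTheory Abelian IsLocalRing RingTheory.Sequence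
open scoped Pointwise

/-- Regular sequences in the maximal ideal may be permuted: move the first element to the end, raise
it to the power there, and move it back. -/
theorem RingTheory.Sequence.IsWeaklyRegular.map_pow {R : Type*} [CommRing R] [IsLocalRing R]
    [IsNoetherianRing R] {M : Type*} [AddCommGroup M] [Module R M] [Module.Finite R M]
    {rs : List R} (hrs : ∀ r ∈ rs, r ∈ maximalIdeal R) (hreg : IsWeaklyRegular M rs) {n : ℕ}
    (hn : n ≠ 0) : IsWeaklyRegular M (rs.map (· ^ n)) := by
  induction rs generalizing M with
  | nil => exact .nil R M
  | cons x rs ih =>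
    have hrs' := fun r hr => hrs r (List.mem_cons_of_mem x hr)
    have hperm : ∀ y : R, (y :: rs).Perm (rs ++ [y]) := fun y =>
      (List.perm_append_singleton y rs).symm
    obtain ⟨h₁, h₂⟩ := (isWeaklyRegular_append_iff M rs [x]).mp
      (IsLocalRing.isWeaklyRegular_of_perm_of_subset_maximalIdeal hreg (hperm x) hrs)
    rw [isWeaklyRegular_singleton_iff] at h₂
    have h₃ : IsWeaklyRegular M (rs ++ [x ^ n]) := (isWeaklyRegular_append_iff M rs [x ^ n]).mpr
      ⟨h₁, (isWeaklyRegular_singleton_iff _ _).mpr (h₂.pow n)⟩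
    have h₄ : IsWeaklyRegular M (x ^ n :: rs) :=
      IsLocalRing.isWeaklyRegular_of_perm_of_subset_maximalIdeal h₃ (hperm _).symm fun r hr => by
        rcases List.mem_append.mp hr with hr | hr
        · exact hrs' r hr
        · rw [List.mem_singleton.mp hr]
          exact Ideal.pow_mem_of_mem _ (hrs x List.mem_cons_self) n (Nat.pos_of_ne_zero hn)
    obtain ⟨h₅, h₆⟩ := (isWeaklyRegular_cons_iff M _ rs).mp h₄
    exact IsWeaklyRegular.cons h₅ (ih hrs' h₆)

/-- Nonvanishing of `Ext^d(k, R)` yields a nonzero map from `k` to the quotient; the image of `1`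
spans the socle by relative injectivity. -/
theorem IsGorensteinLocalRing.exists_socle_generator {R : Type u} [CommRing R]
    [IsGorensteinLocalRing R] {rs : List R} (hrs : ∀ r ∈ rs, r ∈ maximalIdeal R)
    (hreg : IsWeaklyRegular R rs)
    (h : ∀ M : ModuleCat.{u} R, Module.Finite R M →
      Subsingleton (Ext M (ModuleCat.of R R) (rs.length + 1)))
    (hk : ¬ Subsingleton (Ext (ModuleCat.of R (R ⧸ maximalIdeal R)) (ModuleCat.of R R) rs.length)) :
    ∃ t : R ⧸ (Ideal.ofList rs • ⊤ : Submodule R R), t ≠ 0 ∧ (∀ r ∈ maximalIdeal R, r • t = 0) ∧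
      ∀ z : R ⧸ (Ideal.ofList rs • ⊤ : Submodule R R), (∀ r ∈ maximalIdeal R, r • z = 0) →
        ∃ r : R, r • t = z := by
  obtain ⟨f, hf⟩ : ∃ f : (R ⧸ maximalIdeal R) →ₗ[R] R ⧸ (Ideal.ofList rs • ⊤ : Submodule R R),
      f ≠ 0 := by
    by_contra! h
    refine hk (subsingleton_ext_length (ModuleCat.of R (R ⧸ maximalIdeal R)) hreg
      (fun r hr => ?_) (subsingleton_of_forall_eq 0 h))
    rw [Ideal.annihilator_quotient]; exact hrs r hr
  have ht : f (Ideal.Quotient.mk _ 1) ≠ 0 := fun h0 => hf <| LinearMap.ext fun z => by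
    obtain ⟨z, rfl⟩ := Ideal.Quotient.mk_surjective z
    have : Ideal.Quotient.mk (maximalIdeal R) z = z • Ideal.Quotient.mk (maximalIdeal R) 1 := by
      rw [Algebra.smul_def, map_one, mul_one]; rfl
    rw [this, map_smul, h0, smul_zero, LinearMap.zero_apply]
  have hmt : ∀ r ∈ maximalIdeal R, r • f (Ideal.Quotient.mk _ 1) = 0 := fun r hr => by
    have : r • Ideal.Quotient.mk (maximalIdeal R) 1 = 0 := by
      rw [Algebra.smul_def, map_one, mul_one]; exact Ideal.Quotient.eq_zero_iff_mem.mpr hr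
    rw [← map_smul, this, map_zero]
  refine ⟨_, ht, hmt, fun z hz => ?_⟩
  refine (Ideal.isInjectiveModulo_ofList hreg h).exists_smul_eq
    (a := Submodule.Quotient.mk 1) ?_ ?_ ht hmt hz
  · refine eq_top_iff.mpr fun z _ => ?_
    obtain ⟨z, rfl⟩ := Submodule.Quotient.mk_surjective _ z
    exact Submodule.mem_span_singleton.mpr ⟨z, by rw [← Submodule.Quotient.mk_smul]; simp⟩
  · intro r hr
    refine Module.mem_annihilator.mpr fun z => ?_
    obtain ⟨z, rfl⟩ := Submodule.Quotient.mk_surjective _ z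
    rw [← Submodule.Quotient.mk_smul, Submodule.Quotient.mk_eq_zero]
    exact Submodule.smul_mem_smul hr trivial

variable {R : Type u} [CommRing R] (p : ℕ)

instance FrobRoot.instIsLocalRing [IsLocalRing R] (e : ℕ) : IsLocalRing (FrobRoot R p e) :=
  inferInstanceAs (IsLocalRing R)

instance FrobRoot.instIsNoetherianRing [IsNoetherianRing R] (e : ℕ) :
    IsNoetherianRing (FrobRoot R p e) :=
  inferInstanceAs (IsNoetherianRing R)

variable [Fact p.Prime] [CharP R p]

instance FrobRoot.instIsLocalHom (e : ℕ) : IsLocalHom (algebraMap R (FrobRoot R p e)) where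
  map_nonunit r hr := by
    have : IsUnit (r ^ p ^ e) := hr
    exact (isUnit_pow_iff (pow_ne_zero e (Fact.out : p.Prime).ne_zero)).mp this

theorem IsFFinite.module_finite_frobRoot {p : ℕ} [Fact p.Prime] [CharP R p]
    (hF : IsFFinite R p) : Module.Finite R (FrobRoot R p 1) := by
  obtain ⟨s, hs⟩ := hF
  refine ⟨s.map (FrobRoot.root R p 1).toEmbedding, eq_top_iff.mpr fun y _ => ?_⟩
  obtain ⟨y, rfl⟩ := (FrobRoot.root R p 1).surjective y
  have hy : y ∈ Submodule.span (frobenius R p).range (s : Set R) := hs ▸ Submodule.mem_top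
  refine Submodule.span_induction (fun x hx => ?_) ?_ (fun a b _ _ ha hb => ?_)
    (fun c a _ ha => ?_) hy
  · exact Submodule.subset_span (Finset.mem_coe.mpr (Finset.mem_map_of_mem _ hx))
  · rw [map_zero]; exact zero_mem _
  · rw [map_add]; exact add_mem ha hb
  · obtain ⟨_, c, rfl⟩ := c
    have := Submodule.smul_mem _ c ha
    rw [FrobRoot.smul_root, pow_one] at this
    exact this

theorem FrobRoot.isWeaklyRegular [IsLocalRing R] [IsNoetherianRing R] {rs : List R}
    (hrs : ∀ r ∈ rs, r ∈ maximalIdeal R) (hreg : IsWeaklyRegular R rs) (e : ℕ) :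
    IsWeaklyRegular (FrobRoot R p e) rs :=
  (isWeaklyRegular_map_algebraMap_iff (FrobRoot R p e) (FrobRoot R p e) rs).mp
    (hreg.map_pow hrs (pow_ne_zero e (Fact.out : p.Prime).ne_zero))

/-- For an F-finite Gorenstein local ring, `Hom_R(R^{1/p}, R)` is free of rank one over `R^{1/p}`. -/
theorem exists_frobenius_trace [IsGorensteinLocalRing R] (hF : IsFFinite R p) :
    ∃ Ψ : FrobRoot R p 1 →ₗ[R] R, (∀ φ : FrobRoot R p 1 →ₗ[R] R, ∃ s, ∀ y, φ y = Ψ (s * y)) ∧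
      ∀ s, (∀ y, Ψ (s * y) = 0) → s = 0 := by
  have := hF.module_finite_frobRoot
  obtain ⟨rs, hrs, hreg, hExt, hk⟩ := IsGorensteinLocalRing.exists_isWeaklyRegular R
  have hp : p ^ 1 ≠ 0 := pow_ne_zero 1 (Fact.out : p.Prime).ne_zero
  -- Inside `R^{1/p}`, viewed as a copy of `R`, the extension of `(rs)` is the ideal `(rs')`.
  let rs' := rs.map (· ^ p ^ 1)
  have hlen : rs'.length = rs.length := List.length_map _
  have hrs' : ∀ r ∈ rs', r ∈ maximalIdeal R := fun r hr => by
    obtain ⟨r, h, rfl⟩ := List.mem_map.mp hr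
    exact Ideal.pow_mem_of_mem _ (hrs r h) _ (Nat.pos_of_ne_zero hp)
  obtain ⟨t, ht, hmt, hsoc⟩ := IsGorensteinLocalRing.exists_socle_generator hrs hreg
    (hExt _ (Nat.lt_succ_self _)) hk
  obtain ⟨σ, hσ, hmσ, hsocσ⟩ := IsGorensteinLocalRing.exists_socle_generator hrs'
    (hreg.map_pow hrs hp) (hlen ▸ hExt _ (Nat.lt_succ_self _)) (hlen ▸ hk)
  obtain ⟨σ, rfl⟩ := Submodule.Quotient.mk_surjective _ σ
  have hmap : (Ideal.ofList rs).map (algebraMap R (FrobRoot R p 1)) =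
      (Ideal.ofList rs' • ⊤ : Submodule R R) := by
    rw [Ideal.map_ofList, smul_eq_mul, Ideal.mul_top]; rfl
  have hmem : ∀ z : R, FrobRoot.root R p 1 z ∈
      (Ideal.ofList rs).map (algebraMap R (FrobRoot R p 1)) ↔
      z ∈ (Ideal.ofList rs' • ⊤ : Submodule R R) := fun z => by
    rw [hmap]; rfl
  have hm : ∀ s : R, FrobRoot.root R p 1 s ∈ maximalIdeal (FrobRoot R p 1) ↔ s ∈ maximalIdeal R :=
    fun s => Iff.rfl
  have hS : ∀ j, Subsingleton (Ext (ModuleCat.of R (FrobRoot R p 1)) (ModuleCat.of R R) (j + 1)) :=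
    fun j => subsingleton_ext_of_isWeaklyRegular (ModuleCat.of R R) hExt hrs
      (FrobRoot.isWeaklyRegular p hrs hreg 1) (by omega)
  obtain ⟨Ψ, hgen, hann⟩ := exists_generator_of_quotient hrs hreg hS ⊥
    (fun φ s hs => by rw [(Submodule.mem_bot _).mp hs, map_zero]) (by
      obtain ⟨Ψ, hgen, hann⟩ := exists_generator_of_isInjectiveModulo (S := FrobRoot R p 1)
        (Ideal.isInjectiveModulo_ofList hreg (hExt _ (Nat.lt_succ_self _)))
        (fun r hr => Module.mem_annihilator.mpr fun z => by
          obtain ⟨z, rfl⟩ := Submodule.Quotient.mk_surjective _ z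
          rw [← Submodule.Quotient.mk_smul, Submodule.Quotient.mk_eq_zero]
          exact Submodule.smul_mem_smul hr trivial)
        ht hmt hsoc (σ := FrobRoot.root R p 1 σ)
        (by rwa [hmem, ← Submodule.Quotient.mk_eq_zero])
        (fun s hs => by
          obtain ⟨s, rfl⟩ := (FrobRoot.root R p 1).surjective s
          rw [← map_mul, hmem, ← Submodule.Quotient.mk_eq_zero]
          exact hmσ s ((hm s).mp hs))
        (fun z hz => by
          obtain ⟨z, rfl⟩ := (FrobRoot.root R p 1).surjective z
          obtain ⟨s, hs⟩ := hsocσ (Submodule.Quotient.mk z) fun r hr => by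
            rw [← Submodule.Quotient.mk_smul, Submodule.Quotient.mk_eq_zero, ← hmem, smul_eq_mul r z,
              map_mul]
            exact hz _ ((hm r).mpr hr)
          refine ⟨FrobRoot.root R p 1 s, ?_⟩
          rw [← map_mul, ← map_sub, hmem, ← Submodule.Quotient.mk_eq_zero,
            Submodule.Quotient.mk_sub, ← hs, sub_eq_zero]
          rfl)
      exact ⟨Ψ, hgen, fun s hs => by rw [bot_sup_eq]; exact hann s hs⟩)
  exact ⟨Ψ, hgen, fun s hs => (Submodule.mem_bot _).mp (hann s hs)⟩

/-- If `Ψ` generates `Hom_R(R^{1/p}, R)` freely, then compatibility with `Ψ` implies compatibility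
with all `R`-linear maps `R^{1/p^e} → R`. -/
theorem Ideal.IsCompatible.isUniformlyFCompatible {p : ℕ} [Fact p.Prime] [CharP R p]
    {Ψ : FrobRoot R p 1 →ₗ[R] R}
    (hgen : ∀ φ : FrobRoot R p 1 →ₗ[R] R, ∃ s, ∀ y, φ y = Ψ (s * y))
    (hfree : ∀ s, (∀ y, Ψ (s * y) = 0) → s = 0) {J : Ideal R} (hJ : J.IsCompatible Ψ) :
    J.IsUniformlyFCompatible p := by
  intro e
  induction e with
  | zero =>
    intro φ y hy
    obtain ⟨y, rfl⟩ := (FrobRoot.root R p 0).surjective y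
    -- For `e = 0` the map `φ` is multiplication by `φ 1`.
    have : FrobRoot.root R p 0 y = y • FrobRoot.root R p 0 1 := by
      rw [FrobRoot.smul_root, pow_zero, pow_one, mul_one]
    rw [this, map_smul]
    exact J.mul_mem_right _ ((J.root_mem_frobRoot_iff 0 y).mp hy)
  | succ e ih =>
    intro φ y hy
    obtain ⟨y, rfl⟩ := (FrobRoot.root R p (e + 1)).surjective y
    -- For fixed `x` the left side is `R`-linear in `c^{1/p}`, so it is a multiple of `Ψ`. The
    -- multiplier `g x` is unique by freeness, which makes `g` linear on `R^{1/p^e}`; taking `c = 1`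
    -- gives the factorization of `φ` through `Ψ`.
    have hex : ∀ x : R, ∃ s : R, ∀ c : R, φ (FrobRoot.root R p (e + 1) (c ^ p ^ e * x)) =
        Ψ (FrobRoot.root R p 1 (s * c)) := fun x => by
      let φx : FrobRoot R p 1 →ₗ[R] R :=
        { toFun := fun c => φ (FrobRoot.root R p (e + 1) (((FrobRoot.root R p 1).symm c) ^ p ^ e * x))
          map_add' := fun a b => by rw [map_add, add_pow_char_pow, add_mul, map_add, map_add]
          map_smul' := fun r c => by
            obtain ⟨c, rfl⟩ := (FrobRoot.root R p 1).surjective c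
            rw [FrobRoot.smul_root, RingEquiv.symm_apply_apply, RingEquiv.symm_apply_apply, mul_pow,
              ← pow_mul, ← pow_add, add_comm 1 e, mul_assoc, ← FrobRoot.smul_root, map_smul]
            rfl }
      obtain ⟨s, hs⟩ := hgen φx
      obtain ⟨s, rfl⟩ := (FrobRoot.root R p 1).surjective s
      exact ⟨s, fun c => by rw [map_mul _ s c, ← hs]; rfl⟩
    choose g hg using hex
    have hguniq : ∀ x s : R, (∀ c : R, φ (FrobRoot.root R p (e + 1) (c ^ p ^ e * x)) =
        Ψ (FrobRoot.root R p 1 (s * c))) → g x = s := fun x s hs => by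
      refine (FrobRoot.root R p 1).injective (sub_eq_zero.mp (hfree _ fun c => ?_))
      obtain ⟨c, rfl⟩ := (FrobRoot.root R p 1).surjective c
      rw [sub_mul, map_sub, ← map_mul, ← map_mul, ← hs, ← hg, sub_self]
    let G : FrobRoot R p e →ₗ[R] R :=
      { toFun := fun x => g ((FrobRoot.root R p e).symm x)
        map_add' := fun a b => hguniq _ _ fun c => by
          rw [map_add, mul_add, map_add, map_add, add_mul, map_add, map_add, hg, hg]
        map_smul' := fun r a => hguniq _ _ fun c => by
          obtain ⟨a, rfl⟩ := (FrobRoot.root R p e).surjective a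
          rw [FrobRoot.smul_root, RingEquiv.symm_apply_apply, RingEquiv.symm_apply_apply, ← mul_assoc,
            ← mul_pow, hg, RingHom.id_apply, smul_eq_mul, mul_right_comm, mul_left_comm]
          congr 2; ring }
    have hGy : g y ∈ J := ih G (FrobRoot.root R p e y)
      ((J.root_mem_frobRoot_iff e y).mpr ((J.root_mem_frobRoot_iff (e + 1) y).mp hy))
    have hy1 := hg y 1
    rw [one_pow, one_mul, mul_one] at hy1
    rw [hy1]
    exact hJ _ ((J.root_mem_frobRoot_iff 1 _).mpr hGy)

end Frobenius

theorem mainTheorem12 {R : Type u} [CommRing R] (p : ℕ) [Fact p.Prime] [CharP R p]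
    [IsGorensteinLocalRing R] (hF : IsFFinite R p) :
    (⊤ : Submodule (FrobRoot R p 1) (FrobRoot R p 1 →ₗ[R] R)).IsPrincipal ∧
    ∀ Ψ : FrobRoot R p 1 →ₗ[R] R,
      Submodule.span (FrobRoot R p 1) {Ψ} = ⊤ →
      ∀ J : Ideal R, J.IsUniformlyFCompatible p ↔ J.IsCompatible Ψ := by
  obtain ⟨Ψ₀, hgen₀, hfree₀⟩ := exists_frobenius_trace p hF
  refine ⟨⟨Ψ₀, eq_comm.mp (eq_top_iff.mpr fun φ _ => ?_)⟩, fun Ψ hΨ J => ⟨fun h => h 1 Ψ, ?_⟩⟩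
  · obtain ⟨s, hs⟩ := hgen₀ φ
    exact Submodule.mem_span_singleton.mpr ⟨s, LinearMap.ext fun y => (hs y).symm⟩
  · have hgen : ∀ φ : FrobRoot R p 1 →ₗ[R] R, ∃ s, ∀ y, φ y = Ψ (s * y) := fun φ => by
      obtain ⟨s, rfl⟩ := Submodule.mem_span_singleton.mp (hΨ ▸ Submodule.mem_top (x := φ))
      exact ⟨s, fun y => rfl⟩
    -- Freeness passes to any generator `Ψ`: since `Ψ₀` is a multiple of `Ψ`, whatever annihilates
    -- `Ψ` annihilates `Ψ₀`.
    refine fun h => h.isUniformlyFCompatible hgen fun s hs => hfree₀ s fun y => ?_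
    obtain ⟨a, ha⟩ := hgen Ψ₀
    rw [ha, mul_left_comm, hs]
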